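/- **Theorem 3.1.** Let $0<r<1$ and let $\mu$ be the measure on $\mathbb{R}$ with Lebesgue density $$k(x:r)=\frac{\sqrt{1-r^2}}{\pi(1-x^2)\sqrt{r^2-x^2}}\,\mathbf 1_{(-r,r)}(x).$$ Then $\mu$ is a probability measure, and its Stieltjes transform $G_\mu(z)=\int_{\mathbb{R}}\frac{d\mu(x)}{z-x}$ is an absolutely convergent integral for every $z\in\mathbb{C}\setminus[-r,r]$. Let $\sqrt{z^2-r^2}$ denote the branch $z\sqrt{1-r^2/z^2}$ (principal square root), which is holomorphic on $\mathbb{C}\setminus[-r,r]$ and satisfies $\sqrt{z^2-r^2}/z\to1$ as $|z|\to\infty$. Then for every $z\in\mathbb{C}\setminus[-r,r]$ with $z\ne\pm1$, $$G_\mu(z)=\frac{z(z^2-r^2)-\sqrt{1-r^2}\,\sqrt{z^2-r^2}}{(z^2-1)(z^2-r^2)};$$ at $z=\pm1$ the right-hand side has removable singularities, and its limits there are $G_\mu(\pm1)$. Moreover, for every $z\in\mathbb{C}\setminus[-r,r]$, $G_\mu$ admits the continued fraction expansion $$G_\mu(z)=\cfrac{1}{z-\cfrac{\gamma_0}{z-\cfrac{\gamma_1}{z-\cfrac{\gamma_2}{z-\ddots}}}},\qquad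 \gamma_0=1-\sqrt{1-r^2},\quad \gamma_1=\frac{\sqrt{1-r^2}-1+r^2}{2},\quad \gamma_n=\frac{r^2}{4}\ \ (n\ge2),$$ that is, every convergent of the continued fraction has a nonzero denominator at $z$ and the convergents converge to $G_\mu(z)$. -/

import Mathlib

open MeasureTheory Filter Topology

noncomputable section

/-- The density `k(x : r)`, which vanishes outside `(-r, r)`. -/
def konnoDensity (r x : ℝ) : ℝ :=
  (Set.Ioo (-r) r).indicator
    (fun x => Real.sqrt (1 - r ^ 2) / (Real.pi * (1 - x ^ 2) * Real.sqrt (r ^ 2 - x ^ 2))) x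

/-- The measure on the real line with density `k(x : r)` with respect to Lebesgue measure. -/
def konnoMeasure (r : ℝ) : Measure ℝ :=
  volume.withDensity (fun x => ENNReal.ofReal (konnoDensity r x))

/-- The Stieltjes transform `G_μ(z) = ∫ dμ(x) / (z - x)`. -/
def stieltjesTransform (μ : Measure ℝ) (z : ℂ) : ℂ := ∫ x, 1 / (z - (x : ℂ)) ∂μ

/-- The real segment `[-r, r]` as a subset of the complex plane. -/
def realSegment (r : ℝ) : Set ℂ := Complex.ofReal '' Set.Icc (-r) r

/-- The branch of `√(z² - r²)` that is holomorphic off `[-r, r]` and asymptotic to `z` at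
infinity, written with the principal square root of `1 - r² / z²`. The lemmas below check that
it is this branch. -/
def sqrtBranch (r : ℝ) (z : ℂ) : ℂ := z * (1 - (r : ℂ) ^ 2 / z ^ 2) ^ (1 / 2 : ℂ)

theorem sqrtBranch_sq (r : ℝ) {z : ℂ} (hz : z ≠ 0) :
    sqrtBranch r z ^ 2 = z ^ 2 - (r : ℂ) ^ 2 := by
  unfold sqrtBranch
  rw [mul_pow, ← Complex.cpow_nat_mul]
  norm_num
  field_simp

theorem one_sub_div_mem_slitPlane {r : ℝ} {z : ℂ} (hr : 0 < r) (hz : z ∉ realSegment r) :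
    1 - (r : ℂ) ^ 2 / z ^ 2 ∈ Complex.slitPlane := by
  by_contra h
  rw [Complex.mem_slitPlane_iff_not_le_zero, not_not] at h
  have hz0 : z ≠ 0 := by
    rintro rfl
    exact hz ⟨0, ⟨by linarith, hr.le⟩, by simp⟩
  obtain ⟨t, ht0, ht⟩ : ∃ t : ℝ, 0 ≤ t ∧ (r : ℂ) ^ 2 / z ^ 2 = ((1 + t : ℝ) : ℂ) := by
    refine ⟨-(1 - (r : ℂ) ^ 2 / z ^ 2).re, by simpa using (Complex.le_def.1 h).1, ?_⟩
    have him := (Complex.le_def.1 h).2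
    apply Complex.ext
    · simp
    · simp at him ⊢
      exact him
  have hp : (0 : ℝ) < 1 + t := by linarith
  have hw : z ^ 2 = (((r / Real.sqrt (1 + t)) : ℝ) : ℂ) ^ 2 := by
    have h2 : (((r / Real.sqrt (1 + t)) : ℝ)) ^ 2 = r ^ 2 / (1 + t) := by
      rw [div_pow, Real.sq_sqrt hp.le]
    rw [← Complex.ofReal_pow, h2]
    have hc : ((1 + t : ℝ) : ℂ) ≠ 0 := by exact_mod_cast hp.ne'
    have := hz0
    rw [Complex.ofReal_div, eq_div_iff hc, ← ht]
    push_cast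
    field_simp
  have hle : r / Real.sqrt (1 + t) ≤ r :=
    div_le_self hr.le (Real.one_le_sqrt.2 (by linarith))
  have hge : 0 ≤ r / Real.sqrt (1 + t) := by positivity
  rcases sq_eq_sq_iff_eq_or_eq_neg.1 hw with h1 | h1
  · exact hz ⟨_, ⟨by linarith, hle⟩, h1.symm⟩
  · exact hz ⟨-(r / Real.sqrt (1 + t)), ⟨by linarith, by linarith⟩, by rw [h1]; push_cast; rfl⟩

theorem sqrtBranch_differentiableOn {r : ℝ} (hr : 0 < r) :
    DifferentiableOn ℂ (sqrtBranch r) (realSegment r)ᶜ := by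
  intro z hz
  have hz0 : z ≠ 0 := by
    rintro rfl
    exact hz ⟨0, ⟨by linarith, hr.le⟩, by simp⟩
  have h1 : DifferentiableAt ℂ (fun z : ℂ => 1 - (r : ℂ) ^ 2 / z ^ 2) z := by
    refine (differentiableAt_const _).sub ((differentiableAt_const _).div ?_ (pow_ne_zero 2 hz0))
    fun_prop
  exact (differentiableAt_id.mul
    (h1.cpow (differentiableAt_const _)
      (one_sub_div_mem_slitPlane hr hz))).differentiableWithinAt

theorem sqrtBranch_div_tendsto (r : ℝ) :
    Tendsto (fun z => sqrtBranch r z / z) (Bornology.cobounded ℂ) (𝓝 1) := by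
  have h1 : Tendsto (fun z : ℂ => 1 - (r : ℂ) ^ 2 / z ^ 2) (Bornology.cobounded ℂ) (𝓝 1) := by
    have h := ((tendsto_inv₀_cobounded (α := ℂ)).pow 2).const_mul ((r : ℂ) ^ 2)
    simpa [div_eq_mul_inv] using h.const_sub 1
  have h2 : Tendsto (fun z : ℂ => (1 - (r : ℂ) ^ 2 / z ^ 2) ^ (1 / 2 : ℂ))
      (Bornology.cobounded ℂ) (𝓝 1) := by
    simpa using h1.cpow (tendsto_const_nhds (x := (1 / 2 : ℂ))) (by simp)
  refine h2.congr' ?_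
  filter_upwards [Bornology.eventually_ne_cobounded (0 : ℂ)] with z hz
  simp [sqrtBranch, hz]

/-- The right-hand side of the closed formula for the Stieltjes transform. -/
def closedForm (r : ℝ) (z : ℂ) : ℂ :=
  (z * (z ^ 2 - (r : ℂ) ^ 2) - (Real.sqrt (1 - r ^ 2) : ℂ) * sqrtBranch r z) /
    ((z ^ 2 - 1) * (z ^ 2 - (r : ℂ) ^ 2))

/-- The Jacobi coefficients `γ₀, γ₁, γ₂ = γ₃ = ⋯`. -/
def jacobiCoeff (r : ℝ) : ℕ → ℝ
  | 0 => 1 - Real.sqrt (1 - r ^ 2)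
  | 1 => (Real.sqrt (1 - r ^ 2) - 1 + r ^ 2) / 2
  | _ + 2 => r ^ 2 / 4

/-- The infinite continued fraction `1 / (z - γ₀ / (z - γ₁ / (z - γ₂ / ⋯)))`. -/
def jacobiFraction (γ : ℕ → ℝ) (z : ℂ) : GenContFract ℂ where
  h := 0
  s := Stream'.Seq.ofStream fun n =>
    match n with
    | 0 => ⟨1, z⟩
    | m + 1 => ⟨-(γ m : ℂ), z⟩

end

/-! Write `R` for `sqrtBranch r z`. Under `x = r cos θ` the Jacobian cancels the square root in the
density, and partial fractions in `r cos θ` reduce the total mass and `G` to the arcsine integral `∫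
(w - r cos θ)⁻¹ = π / sqrtBranch r w` at `w = 1, -1, z` (`integral_inv_sub_mul_cos`, by Cauchy's
formula). Continuity of `G` then handles `±1`.

For the continued fraction, numerators `N` and denominators `D` solve one three-term recurrence.
From index 2 on its coefficients are constant, with characteristic roots `a = (z + R) / 2` and `b =
(z - R) / 2`, where `‖b‖ < ‖a‖`. The closed formula says exactly that `G * D - N` is the minimal
solution, a multiple of `b ^ n`. A Casoratian equal to `γ₀ γ₁ ≠ 0` makes `D` dominant, so `G - N /
D` tends to 0. Denominators do not vanish by a half-plane argument off the real axis and by a lower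
bound on their ratios on it. -/

/-! ### The branch off the segment. -/

theorem ofReal_notMem_realSegment {r x : ℝ} (hx : r < |x|) : (x : ℂ) ∉ realSegment r := by
  rintro ⟨y, hy, hyx⟩
  rw [Complex.ofReal_inj] at hyx
  subst hyx
  exact absurd (abs_le.2 hy) (not_le.2 hx)

theorem ne_zero_of_notMem_realSegment {r : ℝ} (hr : 0 < r) {z : ℂ} (hz : z ∉ realSegment r) :
    z ≠ 0 := by
  rintro rfl
  exact hz ⟨0, ⟨by linarith, hr.le⟩, by simp⟩

theorem sub_mul_cos_ne_zero {r : ℝ} (hr : 0 < r) {z : ℂ} (hz : z ∉ realSegment r) (θ : ℝ) :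
    z - r * (Real.cos θ : ℂ) ≠ 0 := by
  intro h
  refine hz ⟨r * Real.cos θ, ⟨?_, ?_⟩, ?_⟩
  · nlinarith [Real.neg_one_le_cos θ]
  · nlinarith [Real.cos_le_one θ]
  · rw [Complex.ofReal_mul]
    exact (sub_eq_zero.1 h).symm

theorem sqrtBranch_ne_zero {r : ℝ} (hr : 0 < r) {z : ℂ} (hz : z ∉ realSegment r) :
    sqrtBranch r z ≠ 0 := by
  have h := Complex.slitPlane_ne_zero (one_sub_div_mem_slitPlane hr hz)
  exact mul_ne_zero (ne_zero_of_notMem_realSegment hr hz) (by simp [Complex.cpow_eq_zero_iff, h])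

/-- A principal square root of a slit-plane point has positive real part, so it is closer to `1`
than to `-1`; scale by `z`. This puts the pole in the unit disc in the arcsine integral and
separates the characteristic roots of the recurrence. -/
theorem norm_sub_sqrtBranch_lt {r : ℝ} (hr : 0 < r) {z : ℂ} (hz : z ∉ realSegment r) :
    ‖z - sqrtBranch r z‖ < ‖z + sqrtBranch r z‖ := by
  have hz0 := ne_zero_of_notMem_realSegment hr hz
  have hw := one_sub_div_mem_slitPlane hr hz
  unfold sqrtBranch
  set w : ℂ := 1 - (r : ℂ) ^ 2 / z ^ 2
  have hre : 0 < (w ^ (1 / 2 : ℂ)).re := by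
    rw [Complex.cpow_def_of_ne_zero (Complex.slitPlane_ne_zero hw), Complex.exp_re]
    refine mul_pos (Real.exp_pos _) (Real.cos_pos_of_mem_Ioo ?_)
    have him : (Complex.log w * (1 / 2 : ℂ)).im = w.arg / 2 := by
      rw [show (1 / 2 : ℂ) = ((1 / 2 : ℝ) : ℂ) by push_cast; rfl, Complex.im_mul_ofReal,
        Complex.log_im]
      ring
    rw [him]
    have h1 := Complex.neg_pi_lt_arg w
    have h2 := (Complex.arg_le_pi w).lt_of_ne (Complex.mem_slitPlane_iff_arg.1 hw).1
    constructor <;> linarith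
  set q := w ^ (1 / 2 : ℂ)
  have hq : ‖1 - q‖ < ‖1 + q‖ := by
    rw [← sq_lt_sq₀ (norm_nonneg _) (norm_nonneg _), Complex.sq_norm, Complex.sq_norm,
      Complex.normSq_apply, Complex.normSq_apply]
    simp only [Complex.sub_re, Complex.sub_im, Complex.add_re, Complex.add_im, Complex.one_re,
      Complex.one_im]
    nlinarith
  rw [show z - z * q = z * (1 - q) by ring, show z + z * q = z * (1 + q) by ring, norm_mul,
    norm_mul]
  exact mul_lt_mul_of_pos_left hq (norm_pos_iff.2 hz0)

/-! ### The arcsine integral. -/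

/-- Cauchy's formula for `(1 - u ζ)⁻¹` at `ζ = u`, with `dζ = i ζ dθ`. -/
theorem integral_circleMap_div {u : ℂ} (hu : ‖u‖ < 1) :
    ∫ θ in (0 : ℝ)..2 * Real.pi,
      circleMap 0 1 θ / ((1 - u * circleMap 0 1 θ) * (circleMap 0 1 θ - u)) =
        2 * Real.pi / (1 - u ^ 2) := by
  have hd : DifferentiableOn ℂ (fun ζ : ℂ => (1 - u * ζ)⁻¹) (Metric.closedBall 0 1) := by
    intro ζ hζ
    refine DifferentiableAt.differentiableWithinAt (DifferentiableAt.inv (by fun_prop) ?_)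
    intro h
    have hζ1 : ‖ζ‖ ≤ 1 := by simpa using hζ
    have h1 : ‖u * ζ‖ = 1 := by rw [← sub_eq_zero.1 h, norm_one]
    rw [norm_mul] at h1
    nlinarith [norm_nonneg u, norm_nonneg ζ]
  have h := hd.circleIntegral_sub_inv_smul (w := u) (by simpa using hu)
  rw [circleIntegral] at h
  have hI : ∫ θ in (0 : ℝ)..2 * Real.pi, deriv (circleMap 0 1) θ •
      ((circleMap 0 1 θ - u)⁻¹ • (1 - u * circleMap 0 1 θ)⁻¹) =
      Complex.I * ∫ θ in (0 : ℝ)..2 * Real.pi,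
        circleMap 0 1 θ / ((1 - u * circleMap 0 1 θ) * (circleMap 0 1 θ - u)) := by
    rw [← intervalIntegral.integral_const_mul]
    refine intervalIntegral.integral_congr fun θ _ => ?_
    simp only [deriv_circleMap, smul_eq_mul, div_eq_mul_inv, mul_inv]
    ring
  rw [hI] at h
  refine mul_left_cancel₀ Complex.I_ne_zero (h.trans ?_)
  rw [smul_eq_mul, div_eq_mul_inv, sq]
  ring

theorem integral_comp_cos_zero_two_pi (g : ℝ → ℂ) (hg : Continuous fun θ => g (Real.cos θ)) :
    ∫ θ in (0 : ℝ)..2 * Real.pi, g (Real.cos θ) =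
      2 * ∫ θ in (0 : ℝ)..Real.pi, g (Real.cos θ) := by
  have h : ∫ θ in Real.pi..2 * Real.pi, g (Real.cos θ) =
      ∫ θ in (0 : ℝ)..Real.pi, g (Real.cos θ) := by
    have h1 := intervalIntegral.integral_comp_sub_left (a := 0) (b := Real.pi)
      (fun θ => g (Real.cos θ)) (2 * Real.pi)
    simp only [Real.cos_two_pi_sub, sub_zero] at h1
    rw [h1]
    congr 1
    ring
  rw [← intervalIntegral.integral_add_adjacent_intervals (b := Real.pi)
    (hg.intervalIntegrable _ _) (hg.intervalIntegrable _ _), h, two_mul]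

/-- The Stieltjes transform of the arcsine law on `[-r, r]`. -/
theorem integral_inv_sub_mul_cos {r : ℝ} (hr : 0 < r) {z : ℂ} (hz : z ∉ realSegment r) :
    ∫ θ in (0 : ℝ)..Real.pi, (z - r * (Real.cos θ : ℂ))⁻¹ = Real.pi / sqrtBranch r z := by
  have hz0 := ne_zero_of_notMem_realSegment hr hz
  have hR0 := sqrtBranch_ne_zero hr hz
  have hlt := norm_sub_sqrtBranch_lt hr hz
  have hsq := sqrtBranch_sq r hz0
  set R := sqrtBranch r z
  have hr0 : (r : ℂ) ≠ 0 := by exact_mod_cast hr.ne'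
  have hmul : (z - R) * (z + R) = (r : ℂ) ^ 2 := by linear_combination -hsq
  -- The root inside the unit disc of `r (1 + u²) = 2 u z`; the other root is `u⁻¹`.
  obtain ⟨u, hu⟩ : ∃ u : ℂ, u = (z - R) / r := ⟨_, rfl⟩
  have hru : r * u = z - R := by rw [hu]; field_simp
  have huz : r * (1 + u ^ 2) = 2 * u * z := by
    refine mul_left_cancel₀ hr0 ?_
    linear_combination (r * u + z - R - 2 * z) * hru - hmul
  have hu1 : ‖u‖ < 1 := by
    have h1 : ‖z - R‖ * ‖z + R‖ = r ^ 2 := by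
      rw [← norm_mul, hmul, norm_pow, Complex.norm_real, Real.norm_of_nonneg hr.le]
    rw [hu, norm_div, Complex.norm_real, Real.norm_of_nonneg hr.le, div_lt_one hr]
    nlinarith [norm_nonneg (z - R)]
  have hkey : ∫ θ in (0 : ℝ)..2 * Real.pi, (z - r * (Real.cos θ : ℂ))⁻¹ =
      (2 * u / r) * (2 * Real.pi / (1 - u ^ 2)) := by
    rw [← integral_circleMap_div hu1, ← intervalIntegral.integral_const_mul]
    refine intervalIntegral.integral_congr fun θ _ => ?_
    have hne := sub_mul_cos_ne_zero hr hz θ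
    have hcos : (circleMap 0 1 θ) ^ 2 + 1 = 2 * circleMap 0 1 θ * (Real.cos θ : ℂ) := by
      have h1 : circleMap 0 1 θ = Complex.exp (θ * Complex.I) := by simp [circleMap]
      have h2 : Complex.exp (θ * Complex.I) * Complex.exp (-(θ * Complex.I)) = 1 := by
        rw [← Complex.exp_add]; simp
      rw [h1, Complex.ofReal_cos, Complex.cos, neg_mul]
      linear_combination -h2
    have hζ : circleMap 0 1 θ ≠ 0 := circleMap_ne_center one_ne_zero
    generalize circleMap 0 1 θ = ζ at *
    -- With `ζ = exp (iθ)`, the factor `z - r cos θ` splits over its two zeros `u` and `u⁻¹`.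
    have hden : r * ((1 - u * ζ) * (ζ - u)) = 2 * u * ζ * (z - r * (Real.cos θ : ℂ)) := by
      linear_combination ζ * huz - r * u * hcos
    have hu0 : u ≠ 0 := by
      rintro rfl
      simp [hr0] at huz
    have hden0 : (1 - u * ζ) * (ζ - u) ≠ 0 := by
      intro h
      rw [h, mul_zero] at hden
      exact (mul_ne_zero (mul_ne_zero (mul_ne_zero two_ne_zero hu0) hζ) hne) hden.symm
    rw [div_mul_div_comm, hden, div_mul_eq_div_div, div_self (by simp [hu0, hζ]), one_div]
  have hcont : Continuous fun θ : ℝ => (z - r * (Real.cos θ : ℂ))⁻¹ :=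
    Continuous.inv₀ (by fun_prop) (sub_mul_cos_ne_zero hr hz)
  have h2 := integral_comp_cos_zero_two_pi (fun c => (z - r * (c : ℂ))⁻¹) hcont
  refine mul_left_cancel₀ (two_ne_zero (α := ℂ)) ?_
  rw [← h2, hkey, div_mul_div_comm, mul_div_assoc']
  have hden : r * (1 - u ^ 2) = 2 * u * R := by
    refine mul_left_cancel₀ hr0 ?_
    linear_combination (-(r * u) - z - R) * hru - hmul
  have hu0 : u ≠ 0 := by
    rintro rfl
    simp [hr0] at huz
  rw [hden]
  field_simp

/-! ### Total mass and closed formula. -/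

theorem sqrtBranch_one {r : ℝ} (hr1 : r ^ 2 ≤ 1) :
    sqrtBranch r 1 = Real.sqrt (1 - r ^ 2) := by
  rw [sqrtBranch, Real.sqrt_eq_rpow, Complex.ofReal_cpow (by linarith)]
  push_cast
  simp

theorem sqrtBranch_neg (r : ℝ) (z : ℂ) : sqrtBranch r (-z) = -sqrtBranch r z := by
  simp [sqrtBranch]

/-- Substitution `x = r cos θ`: the Jacobian `r sin θ` cancels `√(r² - x²)`, leaving a weight with
no endpoint singularity. -/
theorem integral_konnoMeasure {r : ℝ} (hr0 : 0 < r) (hr1 : r < 1) (F : ℝ → ℂ) :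
    ∫ x, F x ∂konnoMeasure r = ∫ θ in (0 : ℝ)..Real.pi,
      ((Real.sqrt (1 - r ^ 2) / (Real.pi * (1 - (r * Real.cos θ) ^ 2)) : ℝ) : ℂ) *
        F (r * Real.cos θ) := by
  have hmeas : Measurable (konnoDensity r) := by
    unfold konnoDensity
    exact Measurable.indicator (by fun_prop) measurableSet_Ioo
  have himg : (fun θ => r * Real.cos θ) '' Set.Ioo 0 Real.pi = Set.Ioo (-r) r := by
    ext x
    constructor
    · rintro ⟨θ, hθ, rfl⟩
      have h1 : Real.cos θ < 1 := by
        simpa using Real.cos_lt_cos_of_nonneg_of_le_pi le_rfl hθ.2.le hθ.1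
      have h2 : -1 < Real.cos θ := by
        simpa using Real.cos_lt_cos_of_nonneg_of_le_pi hθ.1.le le_rfl hθ.2
      constructor <;> nlinarith
    · rintro ⟨h1, h2⟩
      have h3 : -1 < x / r := by rw [lt_div_iff₀ hr0]; linarith
      have h4 : x / r < 1 := by rw [div_lt_one hr0]; exact h2
      refine ⟨Real.arccos (x / r), ⟨Real.arccos_pos.2 h4, ?_⟩, ?_⟩
      · refine (Real.arccos_le_pi _).lt_of_ne ?_
        rw [Ne, Real.arccos_eq_pi]
        linarith
      · dsimp only
        rw [Real.cos_arccos h3.le h4.le]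
        field_simp
  have hinj : Set.InjOn (fun θ => r * Real.cos θ) (Set.Ioo 0 Real.pi) := by
    intro a ha b hb hab
    exact Real.injOn_cos (Set.Ioo_subset_Icc_self ha) (Set.Ioo_subset_Icc_self hb)
      (mul_left_cancel₀ hr0.ne' hab)
  rw [konnoMeasure, integral_withDensity_eq_integral_toReal_smul (by fun_prop) (by simp),
    intervalIntegral.integral_of_le Real.pi_pos.le, integral_Ioc_eq_integral_Ioo]
  have hnn : ∀ x, 0 ≤ konnoDensity r x := by
    intro x
    refine Set.indicator_nonneg (fun x hx => ?_) x
    have : 0 < 1 - x ^ 2 := by nlinarith [hx.1, hx.2]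
    positivity
  have hset : ∫ x, (ENNReal.ofReal (konnoDensity r x)).toReal • F x =
      ∫ x in Set.Ioo (-r) r, konnoDensity r x • F x := by
    rw [← integral_indicator measurableSet_Ioo]
    congr 1
    ext x
    rw [ENNReal.toReal_ofReal (hnn x)]
    by_cases hx : x ∈ Set.Ioo (-r) r
    · rw [Set.indicator_of_mem hx]
    · rw [Set.indicator_of_notMem hx, konnoDensity, Set.indicator_of_notMem hx, zero_smul]
  rw [hset, ← himg, integral_image_eq_integral_abs_deriv_smul measurableSet_Ioo
    (fun θ _ => ((Real.hasDerivAt_cos θ).const_mul r).hasDerivWithinAt) hinj]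
  refine setIntegral_congr_fun measurableSet_Ioo fun θ hθ => ?_
  have hsin := Real.sin_pos_of_mem_Ioo hθ
  have hmem : r * Real.cos θ ∈ Set.Ioo (-r) r := by
    rw [← himg]
    exact ⟨θ, hθ, rfl⟩
  have hsqrt : Real.sqrt (r ^ 2 - (r * Real.cos θ) ^ 2) = r * Real.sin θ := by
    rw [show r ^ 2 - (r * Real.cos θ) ^ 2 = (r * Real.sin θ) ^ 2 by
      linear_combination (-r ^ 2) * Real.sin_sq_add_cos_sq θ]
    exact Real.sqrt_sq (by positivity)
  rw [konnoDensity, Set.indicator_of_mem hmem, hsqrt, smul_smul, Complex.real_smul,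
    mul_neg, abs_neg, abs_of_pos (mul_pos hr0 hsin)]
  congr 2
  have : 1 - (r * Real.cos θ) ^ 2 ≠ 0 := by nlinarith [hmem.1, hmem.2]
  field_simp

theorem ae_mem_Ioo_konnoMeasure (r : ℝ) : ∀ᵐ x ∂konnoMeasure r, x ∈ Set.Ioo (-r) r := by
  have hmeas : Measurable (konnoDensity r) := by
    unfold konnoDensity
    exact Measurable.indicator (by fun_prop) measurableSet_Ioo
  rw [konnoMeasure, ae_withDensity_iff (by fun_prop)]
  refine Eventually.of_forall fun x hx => ?_
  by_contra h
  exact hx (by rw [konnoDensity, Set.indicator_of_notMem h, ENNReal.ofReal_zero])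

theorem one_sub_mul_cos_sq_pos {r : ℝ} (hr0 : 0 < r) (hr1 : r < 1) (θ : ℝ) :
    0 < 1 - (r * Real.cos θ) ^ 2 := by
  have h := Real.cos_sq_le_one θ
  rw [mul_pow]
  nlinarith

theorem one_notMem_realSegment {r : ℝ} (hr1 : r < 1) : (1 : ℂ) ∉ realSegment r := by
  simpa using ofReal_notMem_realSegment (r := r) (x := 1) (by simpa using hr1)

theorem neg_one_notMem_realSegment {r : ℝ} (hr1 : r < 1) : (-1 : ℂ) ∉ realSegment r := by
  simpa using ofReal_notMem_realSegment (r := r) (x := -1) (by simpa using hr1)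

theorem intervalIntegrable_inv_sub_mul_cos {r : ℝ} (hr : 0 < r) {z : ℂ} (hz : z ∉ realSegment r)
    (a b : ℝ) : IntervalIntegrable (fun θ : ℝ => (z - r * (Real.cos θ : ℂ))⁻¹) volume a b :=
  (Continuous.inv₀ (by fun_prop) (sub_mul_cos_ne_zero hr hz)).intervalIntegrable _ _

theorem isProbabilityMeasure_konnoMeasure {r : ℝ} (hr0 : 0 < r) (hr1 : r < 1) :
    IsProbabilityMeasure (konnoMeasure r) := by
  have hs : 0 < Real.sqrt (1 - r ^ 2) := Real.sqrt_pos.2 (by nlinarith)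
  have hs0 : (Real.sqrt (1 - r ^ 2) : ℂ) ≠ 0 := by exact_mod_cast hs.ne'
  have hpi : (Real.pi : ℂ) ≠ 0 := by exact_mod_cast Real.pi_ne_zero
  have h := integral_konnoMeasure hr0 hr1 (fun _ => 1)
  have hint : ∫ θ in (0 : ℝ)..Real.pi,
      ((Real.sqrt (1 - r ^ 2) / (Real.pi * (1 - (r * Real.cos θ) ^ 2)) : ℝ) : ℂ) * 1 = 1 := by
    have heq : ∀ θ : ℝ,
        ((Real.sqrt (1 - r ^ 2) / (Real.pi * (1 - (r * Real.cos θ) ^ 2)) : ℝ) : ℂ) * 1 =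
        (Real.sqrt (1 - r ^ 2) / (2 * Real.pi)) *
          ((1 - r * (Real.cos θ : ℂ))⁻¹ - (-1 - r * (Real.cos θ : ℂ))⁻¹) := by
      intro θ
      have h1 := sub_mul_cos_ne_zero hr0 (one_notMem_realSegment hr1) θ
      have h2 := sub_mul_cos_ne_zero hr0 (neg_one_notMem_realSegment hr1) θ
      have h3 : 1 - (r * (Real.cos θ : ℂ)) ^ 2 ≠ 0 := by
        exact_mod_cast (one_sub_mul_cos_sq_pos hr0 hr1 θ).ne'
      rw [inv_sub_inv h1 h2, Complex.ofReal_div, Complex.ofReal_mul, Complex.ofReal_sub,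
        Complex.ofReal_pow, Complex.ofReal_mul, Complex.ofReal_one]
      generalize (Real.cos θ : ℂ) = c at *
      rw [show (1 - r * c) * (-1 - r * c) = -(1 - (r * c) ^ 2) by ring]
      field_simp
      ring
    rw [intervalIntegral.integral_congr fun θ _ => heq θ, intervalIntegral.integral_const_mul,
      intervalIntegral.integral_sub
        (intervalIntegrable_inv_sub_mul_cos hr0 (one_notMem_realSegment hr1) _ _)
        (intervalIntegrable_inv_sub_mul_cos hr0 (neg_one_notMem_realSegment hr1) _ _),
      integral_inv_sub_mul_cos hr0 (one_notMem_realSegment hr1),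
      integral_inv_sub_mul_cos hr0 (neg_one_notMem_realSegment hr1), sqrtBranch_neg,
      sqrtBranch_one (by nlinarith)]
    field_simp
    ring
  rw [hint, integral_const, Complex.real_smul, mul_one, Complex.ofReal_eq_one,
    measureReal_def, ENNReal.toReal_eq_one_iff] at h
  exact ⟨h⟩

theorem stieltjesTransform_eq_closedForm {r : ℝ} (hr0 : 0 < r) (hr1 : r < 1) {z : ℂ}
    (hz : z ∉ realSegment r) (hz1 : z ≠ 1) (hz2 : z ≠ -1) :
    stieltjesTransform (konnoMeasure r) z = closedForm r z := by
  have hs : 0 < Real.sqrt (1 - r ^ 2) := Real.sqrt_pos.2 (by nlinarith)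
  have hs0 : (Real.sqrt (1 - r ^ 2) : ℂ) ≠ 0 := by exact_mod_cast hs.ne'
  have hpi : (Real.pi : ℂ) ≠ 0 := by exact_mod_cast Real.pi_ne_zero
  have hz1' : z - 1 ≠ 0 := sub_ne_zero.2 hz1
  have hz2' : z + 1 ≠ 0 := fun h => hz2 (eq_neg_of_add_eq_zero_left h)
  -- Partial fractions in `c = r cos θ`, with poles `1`, `-1` and `z`; they are distinct because `z
  -- ≠ ±1`.
  have heq : ∀ θ : ℝ,
      ((Real.sqrt (1 - r ^ 2) / (Real.pi * (1 - (r * Real.cos θ) ^ 2)) : ℝ) : ℂ) *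
        (1 / (z - ((r * Real.cos θ : ℝ) : ℂ))) =
      (Real.sqrt (1 - r ^ 2) / Real.pi) *
        ((2 * (z - 1))⁻¹ * (1 - r * (Real.cos θ : ℂ))⁻¹ -
          (2 * (z + 1))⁻¹ * (-1 - r * (Real.cos θ : ℂ))⁻¹ -
          ((z - 1) * (z + 1))⁻¹ * (z - r * (Real.cos θ : ℂ))⁻¹) := by
    intro θ
    have h0 := sub_mul_cos_ne_zero hr0 hz θ
    have h1 := sub_mul_cos_ne_zero hr0 (one_notMem_realSegment hr1) θ
    have h2 := sub_mul_cos_ne_zero hr0 (neg_one_notMem_realSegment hr1) θ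
    have h3 : 1 - (r * (Real.cos θ : ℂ)) ^ 2 ≠ 0 := by
      exact_mod_cast (one_sub_mul_cos_sq_pos hr0 hr1 θ).ne'
    rw [Complex.ofReal_div, Complex.ofReal_mul, Complex.ofReal_sub,
      Complex.ofReal_pow, Complex.ofReal_mul, Complex.ofReal_one]
    generalize (r * (Real.cos θ : ℂ)) = c at *
    field_simp
    ring
  have i0 := intervalIntegrable_inv_sub_mul_cos hr0 hz 0 Real.pi
  have i1 := intervalIntegrable_inv_sub_mul_cos hr0 (one_notMem_realSegment hr1) 0 Real.pi
  have i2 := intervalIntegrable_inv_sub_mul_cos hr0 (neg_one_notMem_realSegment hr1) 0 Real.pi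
  rw [stieltjesTransform, integral_konnoMeasure hr0 hr1,
    intervalIntegral.integral_congr fun θ _ => heq θ, intervalIntegral.integral_const_mul,
    intervalIntegral.integral_sub ((i1.const_mul _).sub (i2.const_mul _)) (i0.const_mul _),
    intervalIntegral.integral_sub (i1.const_mul _) (i2.const_mul _),
    intervalIntegral.integral_const_mul, intervalIntegral.integral_const_mul,
    intervalIntegral.integral_const_mul, integral_inv_sub_mul_cos hr0 hz,
    integral_inv_sub_mul_cos hr0 (one_notMem_realSegment hr1),
    integral_inv_sub_mul_cos hr0 (neg_one_notMem_realSegment hr1), sqrtBranch_neg,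
    sqrtBranch_one (by nlinarith), closedForm,
    ← sqrtBranch_sq r (ne_zero_of_notMem_realSegment hr0 hz)]
  have hR0 := sqrtBranch_ne_zero hr0 hz
  generalize sqrtBranch r z = R at *
  rw [show z ^ 2 - 1 = (z - 1) * (z + 1) by ring]
  field_simp
  ring

/-! ### Integrability, continuity, and passage to `±1`. -/

theorem isCompact_realSegment (r : ℝ) : IsCompact (realSegment r) :=
  isCompact_Icc.image Complex.continuous_ofReal

theorem integrable_konnoMeasure {r : ℝ} (hr0 : 0 < r) (hr1 : r < 1) {z : ℂ}
    (hz : z ∉ realSegment r) :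
    Integrable (fun x : ℝ => 1 / (z - (x : ℂ))) (konnoMeasure r) := by
  have := isProbabilityMeasure_konnoMeasure hr0 hr1
  obtain ⟨δ, hδ, hb⟩ :=
    Metric.isOpen_iff.1 (isCompact_realSegment r).isClosed.isOpen_compl z hz
  refine Integrable.of_bound (Measurable.aestronglyMeasurable (by fun_prop)) δ⁻¹ ?_
  filter_upwards [ae_mem_Ioo_konnoMeasure r] with x hx
  rw [norm_div, norm_one, one_div]
  refine inv_anti₀ hδ (le_of_not_gt fun h => ?_)
  refine hb (?_ : (x : ℂ) ∈ Metric.ball z δ) ⟨x, Set.Ioo_subset_Icc_self hx, rfl⟩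
  rwa [Metric.mem_ball, dist_comm, dist_eq_norm]

theorem continuousAt_stieltjesTransform {r : ℝ} (hr0 : 0 < r) (hr1 : r < 1) {z : ℂ}
    (hz : z ∉ realSegment r) : ContinuousAt (stieltjesTransform (konnoMeasure r)) z := by
  have := isProbabilityMeasure_konnoMeasure hr0 hr1
  obtain ⟨δ, hδ, hb⟩ :=
    Metric.isOpen_iff.1 (isCompact_realSegment r).isClosed.isOpen_compl z hz
  have hfar : ∀ x ∈ Set.Ioo (-r) r, δ ≤ ‖z - x‖ := by
    intro x hx
    refine le_of_not_gt fun h => ?_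
    refine hb (?_ : (x : ℂ) ∈ Metric.ball z δ) ⟨x, Set.Ioo_subset_Icc_self hx, rfl⟩
    rwa [Metric.mem_ball, dist_comm, dist_eq_norm]
  refine continuousAt_of_dominated (bound := fun _ => (δ / 2)⁻¹)
    (Eventually.of_forall fun w => Measurable.aestronglyMeasurable (by fun_prop)) ?_ (integrable_const _) ?_
  · filter_upwards [Metric.ball_mem_nhds z (half_pos hδ)] with w hw
    filter_upwards [ae_mem_Ioo_konnoMeasure r] with x hx
    rw [norm_div, norm_one, one_div]
    refine inv_anti₀ (half_pos hδ) ?_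
    rw [Metric.mem_ball, dist_comm, dist_eq_norm] at hw
    have h1 := hfar x hx
    have h2 : ‖z - x‖ ≤ ‖z - w‖ + ‖w - x‖ := by
      simpa using norm_add_le (z - w) (w - x)
    linarith
  · filter_upwards [ae_mem_Ioo_konnoMeasure r] with x hx
    have h1 : z - (x : ℂ) ≠ 0 := norm_pos_iff.1 (hδ.trans_le (hfar x hx))
    exact ContinuousAt.div (by fun_prop) (by fun_prop) h1

theorem tendsto_closedForm {r : ℝ} (hr0 : 0 < r) (hr1 : r < 1) {z : ℂ} (hz : z ∉ realSegment r) :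
    Tendsto (closedForm r) (𝓝[≠] z) (𝓝 (stieltjesTransform (konnoMeasure r) z)) := by
  refine ((continuousAt_stieltjesTransform hr0 hr1 hz).mono_left nhdsWithin_le_nhds).congr' ?_
  -- Near `z` the only possible exceptional point is `z` itself, which the punctured filter omits.
  have hfin : ({1, -1} \ {z} : Set ℂ)ᶜ ∈ 𝓝 z :=
    (Set.Finite.isClosed (by simp)).isOpen_compl.mem_nhds (by simp)
  filter_upwards [nhdsWithin_le_nhds hfin, self_mem_nhdsWithin,
    nhdsWithin_le_nhds ((isCompact_realSegment r).isClosed.isOpen_compl.mem_nhds hz)]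
    with w hw hwz hws
  have hw' : w ≠ 1 ∧ w ≠ -1 := by
    constructor <;> rintro rfl <;> exact hw ⟨by simp, hwz⟩
  exact stieltjesTransform_eq_closedForm hr0 hr1 hws hw'.1 hw'.2

/-- The closed formula for the Stieltjes transform with its denominators cleared, which is
valid at `z = ±1` too. It says that the remainders of order two and three of the continued
fraction have ratio `(z - √(z² - r²)) / 2`. -/
theorem stieltjesTransform_mul_eq {r : ℝ} (hr0 : 0 < r) (hr1 : r < 1) {z : ℂ}
    (hz : z ∉ realSegment r) :
    stieltjesTransform (konnoMeasure r) z *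
      ((z + sqrtBranch r z) / 2 * (z ^ 2 - jacobiCoeff r 0) - jacobiCoeff r 1 * z) =
      (z + sqrtBranch r z) / 2 * z - jacobiCoeff r 1 := by
  have hoff : ∀ w : ℂ, w ∉ realSegment r → w ≠ 1 → w ≠ -1 →
      stieltjesTransform (konnoMeasure r) w *
      ((w + sqrtBranch r w) / 2 * (w ^ 2 - jacobiCoeff r 0) - jacobiCoeff r 1 * w) =
      (w + sqrtBranch r w) / 2 * w - jacobiCoeff r 1 := by
    intro w hw hw1 hw2
    have hR0 := sqrtBranch_ne_zero hr0 hw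
    have hsq := sqrtBranch_sq r (ne_zero_of_notMem_realSegment hr0 hw)
    have hw3 : w ^ 2 - 1 ≠ 0 := by
      rw [show w ^ 2 - 1 = (w - 1) * (w + 1) by ring]
      exact mul_ne_zero (sub_ne_zero.2 hw1) fun h => hw2 (eq_neg_of_add_eq_zero_left h)
    have hs : (Real.sqrt (1 - r ^ 2) : ℂ) ^ 2 = 1 - (r : ℂ) ^ 2 := by
      rw [← Complex.ofReal_pow, Real.sq_sqrt (by nlinarith)]
      push_cast
      rfl
    rw [stieltjesTransform_eq_closedForm hr0 hr1 hw hw1 hw2, closedForm, ← hsq]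
    simp only [jacobiCoeff]
    push_cast
    generalize (Real.sqrt (1 - r ^ 2) : ℂ) = s at *
    generalize sqrtBranch r w = R at *
    -- Eliminating `r²` leaves a polynomial identity in `w, R, s` modulo the single relation `w² =
    -- R² + 1 - s²`.
    have hr2 : (r : ℂ) ^ 2 = 1 - s ^ 2 := by linear_combination hs
    rw [hr2] at hsq ⊢
    have hw4 : w ^ 2 = R ^ 2 + 1 - s ^ 2 := by linear_combination -hsq
    rw [div_mul_eq_mul_div, div_eq_iff (mul_ne_zero hw3 (pow_ne_zero 2 hR0))]
    grind
  have hcR : ContinuousAt (sqrtBranch r) z :=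
    ((sqrtBranch_differentiableOn hr0).differentiableAt
      ((isCompact_realSegment r).isClosed.isOpen_compl.mem_nhds hz)).continuousAt
  have hcG := continuousAt_stieltjesTransform hr0 hr1 hz
  have hl : ContinuousAt (fun w => stieltjesTransform (konnoMeasure r) w *
      ((w + sqrtBranch r w) / 2 * (w ^ 2 - jacobiCoeff r 0) - jacobiCoeff r 1 * w)) z := by
    fun_prop
  have hrr : ContinuousAt (fun w => (w + sqrtBranch r w) / 2 * w - jacobiCoeff r 1) z := by
    fun_prop
  refine tendsto_nhds_unique_of_eventuallyEq (hl.mono_left (nhdsWithin_le_nhds (s := {z}ᶜ)))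
    (hrr.mono_left nhdsWithin_le_nhds) ?_
  have hfin : ({1, -1} \ {z} : Set ℂ)ᶜ ∈ 𝓝 z :=
    (Set.Finite.isClosed (by simp)).isOpen_compl.mem_nhds (by simp)
  filter_upwards [nhdsWithin_le_nhds hfin, self_mem_nhdsWithin,
    nhdsWithin_le_nhds ((isCompact_realSegment r).isClosed.isOpen_compl.mem_nhds hz)]
    with w hw hwz hws
  have hw' : w ≠ 1 ∧ w ≠ -1 := by
    constructor <;> rintro rfl <;> exact hw ⟨by simp, hwz⟩
  exact hoff w hws hw'.1 hw'.2

/-! ### Nonvanishing of the denominators. -/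

/-- The ratios `t = D (n + 1) / D n` evolve by `t ↦ z - γ n / t`, which preserves the open
half-plane containing `z` when `γ n ≥ 0`. -/
theorem ne_zero_of_recurrence_of_im_ne_zero {γ : ℕ → ℝ} (hγ : ∀ n, 0 ≤ γ n) {z : ℂ}
    (hz : z.im ≠ 0) {D : ℕ → ℂ} (h0 : D 0 = 1) (h1 : D 1 = z)
    (hD : ∀ n, D (n + 2) = z * D (n + 1) - γ n * D n) (n : ℕ) : D n ≠ 0 := by
  have key : ∀ n, D n ≠ 0 ∧ 0 < z.im * (D (n + 1) / D n).im := by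
    intro n
    induction n with
    | zero => simpa [h0, h1] using mul_self_pos.2 hz
    | succ n ih =>
      obtain ⟨hn, hpos⟩ := ih
      have hn1 : D (n + 1) ≠ 0 := by
        intro h
        simp [h] at hpos
      refine ⟨hn1, ?_⟩
      have ht : D (n + 2) / D (n + 1) = z - γ n * (D (n + 1) / D n)⁻¹ := by
        rw [hD]
        field_simp
      rw [show n + 1 + 1 = n + 2 from rfl, ht, Complex.sub_im, Complex.im_ofReal_mul,
        Complex.inv_im]
      generalize D (n + 1) / D n = t at *
      have h2 : 0 ≤ γ n * (z.im * t.im) / Complex.normSq t :=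
        div_nonneg (mul_nonneg (hγ n) hpos.le) (Complex.normSq_nonneg t)
      have h3 : z.im * (z.im - γ n * (-t.im / Complex.normSq t)) =
          z.im * z.im + γ n * (z.im * t.im) / Complex.normSq t := by ring
      rw [h3]
      exact add_pos_of_pos_of_nonneg (mul_self_pos.2 hz) h2
  exact (key n).1

theorem sqrt_one_sub_sq_mem_Ioo {r : ℝ} (hr0 : 0 < r) (hr1 : r < 1) :
    Real.sqrt (1 - r ^ 2) ∈ Set.Ioo (0 : ℝ) 1 := by
  refine ⟨Real.sqrt_pos.2 (by nlinarith), ?_⟩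
  rw [Real.sqrt_lt' one_pos]
  nlinarith

theorem jacobiCoeff_pos {r : ℝ} (hr0 : 0 < r) (hr1 : r < 1) (n : ℕ) : 0 < jacobiCoeff r n := by
  obtain ⟨hs0, hs1⟩ := sqrt_one_sub_sq_mem_Ioo hr0 hr1
  have hsq : Real.sqrt (1 - r ^ 2) ^ 2 = 1 - r ^ 2 := Real.sq_sqrt (by nlinarith)
  match n with
  | 0 => simpa [jacobiCoeff] using hs1
  | 1 =>
    simp only [jacobiCoeff]
    nlinarith
  | n + 2 =>
    simp only [jacobiCoeff]
    positivity

/-- The ratio bound `r / 2` is the double characteristic root at `x = r`, so the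
constant-coefficient recurrence propagates it for `x > r`. It must start at `D 3 / D 2`, since `D 2
/ D 1` can be smaller. -/
theorem recurrence_pos_of_lt {r : ℝ} (hr0 : 0 < r) (hr1 : r < 1) {x : ℝ} (hx : r < x)
    {D : ℕ → ℝ} (h0 : D 0 = 1) (h1 : D 1 = x)
    (hD : ∀ n, D (n + 2) = x * D (n + 1) - jacobiCoeff r n * D n) (n : ℕ) : 0 < D n := by
  obtain ⟨hs0, hs1⟩ := sqrt_one_sub_sq_mem_Ioo hr0 hr1
  have hsq : Real.sqrt (1 - r ^ 2) ^ 2 = 1 - r ^ 2 := Real.sq_sqrt (by nlinarith)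
  have h2 := hD 0
  have h3 := hD 1
  simp only [zero_add, h0, h1, jacobiCoeff, Nat.reduceAdd] at h2 h3
  set s := Real.sqrt (1 - r ^ 2)
  have hD2 : 0 < D 2 := by nlinarith
  have hD3 : r / 2 * D 2 < D 3 := by
    rw [h3]
    have hr2 : s - 1 + r ^ 2 = s * (1 - s) := by linarith
    rw [hr2]
    -- The difference of the two sides is `(x - r) * (r * x + 1 - s)`.
    have e1 : s * (1 - s) * x ≤ r * D 2 := by
      rw [h2]
      nlinarith [mul_pos (sub_pos.2 hx) (sub_pos.2 hs1), mul_pos (sub_pos.2 hx) hr0,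
        mul_pos (mul_pos (sub_pos.2 hx) hr0) (hr0.trans hx)]
    nlinarith
  have key : ∀ n, 0 < D (n + 2) ∧ r / 2 * D (n + 2) < D (n + 3) := by
    intro n
    induction n with
    | zero => exact ⟨hD2, hD3⟩
    | succ n ih =>
      obtain ⟨hp, hlt⟩ := ih
      have hp' : 0 < D (n + 3) := lt_trans (by positivity) hlt
      refine ⟨hp', ?_⟩
      have h4 := hD (n + 2)
      simp only [jacobiCoeff] at h4
      rw [show n + 1 + 3 = n + 2 + 2 from rfl, h4, show n + 1 + 2 = n + 3 from rfl,
        show n + 2 + 1 = n + 3 from rfl]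
      nlinarith [mul_pos (sub_pos.2 hx) hp', mul_lt_mul_of_pos_left hlt hr0]
  match n with
  | 0 => rw [h0]; exact one_pos
  | 1 => rw [h1]; exact hr0.trans hx
  | n + 2 => exact (key n).1

theorem exists_real_recurrence (γ : ℕ → ℝ) (x : ℝ) :
    ∃ D : ℕ → ℝ, D 0 = 1 ∧ D 1 = x ∧ ∀ n, D (n + 2) = x * D (n + 1) - γ n * D n := by
  let P : ℕ → ℝ × ℝ := fun n => Nat.rec (1, x) (fun n p => (p.2, x * p.2 - γ n * p.1)) n
  exact ⟨fun n => (P n).1, rfl, rfl, fun n => rfl⟩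

theorem recurrence_ne_zero {r : ℝ} (hr0 : 0 < r) (hr1 : r < 1) {z : ℂ} (hz : z ∉ realSegment r)
    {D : ℕ → ℂ} (h0 : D 0 = 1) (h1 : D 1 = z)
    (hD : ∀ n, D (n + 2) = z * D (n + 1) - jacobiCoeff r n * D n) (n : ℕ) : D n ≠ 0 := by
  by_cases him : z.im = 0
  -- On the real axis, the parity `D n (-x) = (-1) ^ n * D n x` reduces to `x > r`; `σ` is the sign.
  · obtain ⟨σ, x, hσ, hx, hzx⟩ : ∃ σ x : ℝ, σ ^ 2 = 1 ∧ r < x ∧ z = σ * x := by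
      have hzre : z = (z.re : ℂ) := Complex.ext rfl (by simpa using him)
      by_cases hle : z.re ≤ r
      · have hlt : z.re < -r := by
          by_contra h
          exact hz ⟨z.re, ⟨not_lt.1 h, hle⟩, hzre.symm⟩
        exact ⟨-1, -z.re, by norm_num, by linarith, by rw [hzre]; simp⟩
      · exact ⟨1, z.re, by norm_num, not_le.1 hle, by rw [hzre]; simp⟩
    obtain ⟨E, e0, e1, hE⟩ := exists_real_recurrence (jacobiCoeff r) x
    have hσ' : (σ : ℂ) ^ 2 = 1 := by exact_mod_cast hσ
    have key : ∀ n, D n = σ ^ n * E n ∧ D (n + 1) = σ ^ (n + 1) * E (n + 1) := by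
      intro n
      induction n with
      | zero => simp [h0, h1, e0, e1, hzx]
      | succ n ih =>
        refine ⟨ih.2, ?_⟩
        rw [hD, ih.1, ih.2, hE, hzx]
        push_cast
        linear_combination ((jacobiCoeff r n : ℂ) * σ ^ n * E n) * hσ'
    rw [(key n).1]
    have hE0 := (recurrence_pos_of_lt hr0 hr1 hx e0 e1 hE n).ne'
    have hσ0 : (σ : ℂ) ≠ 0 := by
      rintro h
      simp [h] at hσ'
    exact mul_ne_zero (pow_ne_zero _ hσ0) (by exact_mod_cast hE0)
  · exact ne_zero_of_recurrence_of_im_ne_zero (fun n => (jacobiCoeff_pos hr0 hr1 n).le) him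
      h0 h1 hD n

/-! ### Convergence of the convergents. -/

/-- In terms of the shift `S` the recurrence is `(S - a)(S - b) d = 0`, so `(S - b) d` is geometric.
-/
theorem eq_pow_mul_of_recurrence {a b : ℂ} {d : ℕ → ℂ}
    (hd : ∀ n, d (n + 2) = (a + b) * d (n + 1) - a * b * d n) (n : ℕ) :
    d (n + 1) - b * d n = a ^ n * (d 1 - b * d 0) := by
  induction n with
  | zero => simp
  | succ n ih =>
    rw [hd, pow_succ]
    linear_combination a * ih

/-- If `e` is a minimal and `d` a dominant solution of the recurrence with characteristic roots
`a` and `b`, where `‖b‖ < ‖a‖`, then `e / d` tends to zero. -/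
theorem tendsto_div_of_recurrence {a b : ℂ} (hab : ‖b‖ < ‖a‖) {d e : ℕ → ℂ}
    (hd : ∀ n, d (n + 2) = (a + b) * d (n + 1) - a * b * d n)
    (he : ∀ n, e (n + 2) = (a + b) * e (n + 1) - a * b * e n)
    (hδ : d 1 - b * d 0 ≠ 0) (he1 : e 1 = b * e 0) :
    Tendsto (fun n => e n / d n) atTop (𝓝 0) := by
  have ha : a ≠ 0 := norm_pos_iff.1 ((norm_nonneg b).trans_lt hab)
  have hne : a - b ≠ 0 := fun h => hab.ne (by rw [sub_eq_zero.1 h])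
  have hen : ∀ n, e n = b ^ n * e 0 := by
    intro n
    induction n with
    | zero => simp
    | succ n ih =>
      have h := eq_pow_mul_of_recurrence he n
      rw [he1, sub_self, mul_zero, sub_eq_zero] at h
      rw [h, ih, pow_succ]
      ring
  -- Apply the factorization in both orders and subtract to eliminate `d (n + 1)`.
  have hdn : ∀ n, d n * (a - b) = a ^ n * (d 1 - b * d 0) - b ^ n * (d 1 - a * d 0) := by
    intro n
    have h1 := eq_pow_mul_of_recurrence hd n
    have h2 := eq_pow_mul_of_recurrence (a := b) (b := a) (d := d)
      (fun n => by rw [hd]; ring) n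
    linear_combination h1 - h2
  have hρ : Tendsto (fun n : ℕ => (b / a) ^ n) atTop (𝓝 0) := by
    apply tendsto_pow_atTop_nhds_zero_of_norm_lt_one
    rwa [norm_div, div_lt_one (norm_pos_iff.2 ha)]
  have hlim : Tendsto (fun n : ℕ => (b / a) ^ n * (e 0 * (a - b)) /
      ((d 1 - b * d 0) - (b / a) ^ n * (d 1 - a * d 0))) atTop (𝓝 0) := by
    have h := (hρ.mul_const (e 0 * (a - b))).div
      ((hρ.mul_const (d 1 - a * d 0)).const_sub (d 1 - b * d 0)) (by simpa using hδ)
    simpa [Pi.div_def] using h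
  refine hlim.congr fun n => ?_
  rw [← mul_div_mul_right (e n) (d n) hne, hdn, hen n,
    ← mul_div_mul_left _ _ (pow_ne_zero n ha), div_pow]
  congr 1 <;> field_simp

theorem jacobiFraction_recurrence (γ : ℕ → ℝ) (z : ℂ) :
    (jacobiFraction γ z).nums 0 = 0 ∧ (jacobiFraction γ z).nums 1 = 1 ∧
    (∀ n, (jacobiFraction γ z).nums (n + 2) =
      z * (jacobiFraction γ z).nums (n + 1) - γ n * (jacobiFraction γ z).nums n) ∧
    (jacobiFraction γ z).dens 0 = 1 ∧ (jacobiFraction γ z).dens 1 = z ∧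
    (∀ n, (jacobiFraction γ z).dens (n + 2) =
      z * (jacobiFraction γ z).dens (n + 1) - γ n * (jacobiFraction γ z).dens n) := by
  have hs0 : (jacobiFraction γ z).s.get? 0 = some ⟨1, z⟩ := rfl
  have hs : ∀ n, (jacobiFraction γ z).s.get? (n + 1) = some ⟨-(γ n : ℂ), z⟩ := fun n => rfl
  refine ⟨by simp [jacobiFraction], ?_, fun n => ?_, by simp, ?_, fun n => ?_⟩
  · rw [GenContFract.first_num_eq hs0]
    simp [jacobiFraction]
  · rw [GenContFract.nums_recurrence (hs n) rfl rfl]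
    ring
  · rw [GenContFract.first_den_eq hs0]
  · rw [GenContFract.dens_recurrence (hs n) rfl rfl]
    ring

theorem tendsto_div_stieltjesTransform {r : ℝ} (hr0 : 0 < r) (hr1 : r < 1) {z : ℂ}
    (hz : z ∉ realSegment r) {N D : ℕ → ℂ} (n0 : N 0 = 0) (n1 : N 1 = 1)
    (hn : ∀ n, N (n + 2) = z * N (n + 1) - jacobiCoeff r n * N n) (d0 : D 0 = 1) (d1 : D 1 = z)
    (hd : ∀ n, D (n + 2) = z * D (n + 1) - jacobiCoeff r n * D n) (hne : ∀ n, D n ≠ 0) :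
    Tendsto (fun n => N n / D n) atTop (𝓝 (stieltjesTransform (konnoMeasure r) z)) := by
  have hG := stieltjesTransform_mul_eq hr0 hr1 hz
  have hsq := sqrtBranch_sq r (ne_zero_of_notMem_realSegment hr0 hz)
  have hlt := norm_sub_sqrtBranch_lt hr0 hz
  set G := stieltjesTransform (konnoMeasure r) z
  set R := sqrtBranch r z
  have hn2 := hn 0
  have hn3 := hn 1
  have hd2 := hd 0
  have hd3 := hd 1
  simp only [zero_add, Nat.reduceAdd, n0, n1, d0, d1] at hn2 hn3 hd2 hd3
  have hγ : ∀ n, (jacobiCoeff r (n + 2) : ℂ) = (z + R) / 2 * ((z - R) / 2) := by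
    intro n
    simp only [jacobiCoeff]
    push_cast
    linear_combination (1 / 4 : ℂ) * hsq
  have hγ0 : (jacobiCoeff r 0 : ℂ) ≠ 0 := by exact_mod_cast (jacobiCoeff_pos hr0 hr1 0).ne'
  have hγ1 : (jacobiCoeff r 1 : ℂ) ≠ 0 := by exact_mod_cast (jacobiCoeff_pos hr0 hr1 1).ne'
  have he1 : G * D 3 - N 3 = (z - R) / 2 * (G * D 2 - N 2) := by
    rw [hn3, hd3, hn2, hd2]
    linear_combination hG
  -- If `D` were minimal, `N` would be too by `he1`, so the Casoratian `N 3 * D 2 - N 2 * D 3 = γ₀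
  -- γ₁` would vanish.
  have hδ : D 3 - (z - R) / 2 * D 2 ≠ 0 := by
    intro h
    refine mul_ne_zero hγ0 hγ1 ?_
    have h1 : N 3 - (z - R) / 2 * N 2 = 0 := by linear_combination G * h - he1
    have h2 : N 3 * D 2 - N 2 * D 3 = 0 := by linear_combination D 2 * h1 - N 2 * h
    rw [hn3, hd3, hn2, hd2] at h2
    linear_combination h2
  have hab : ‖(z - R) / 2‖ < ‖(z + R) / 2‖ := by
    rw [norm_div, norm_div]
    exact div_lt_div_of_pos_right hlt (by simp)
  have hlim := tendsto_div_of_recurrence hab (d := fun n => D (n + 2))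
    (e := fun n => G * D (n + 2) - N (n + 2))
    (fun n => by rw [hd (n + 2), hγ]; ring)
    (fun n => by rw [hd (n + 2), hn (n + 2), hγ]; ring) hδ he1
  refine (tendsto_add_atTop_iff_nat 2).1 ?_
  have h := hlim.const_sub G
  rw [sub_zero] at h
  refine h.congr fun n => ?_
  have := hne (n + 2)
  field_simp
  ring

theorem theorem3p1 (r : ℝ) (hr0 : 0 < r) (hr1 : r < 1) :
    IsProbabilityMeasure (konnoMeasure r) ∧
    (∀ z : ℂ, z ∉ realSegment r →
      Integrable (fun x : ℝ => 1 / (z - (x : ℂ))) (konnoMeasure r)) ∧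
    (∀ z : ℂ, z ∉ realSegment r → z ≠ 1 → z ≠ -1 →
      stieltjesTransform (konnoMeasure r) z = closedForm r z) ∧
    (∀ z : ℂ, z = 1 ∨ z = -1 →
      Tendsto (closedForm r) (𝓝[≠] z) (𝓝 (stieltjesTransform (konnoMeasure r) z))) ∧
    (∀ z : ℂ, z ∉ realSegment r →
      (∀ n : ℕ, (jacobiFraction (jacobiCoeff r) z).dens n ≠ 0) ∧
      Tendsto (fun n : ℕ => (jacobiFraction (jacobiCoeff r) z).convs n) atTop
        (𝓝 (stieltjesTransform (konnoMeasure r) z))) := by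
  refine ⟨isProbabilityMeasure_konnoMeasure hr0 hr1, fun z hz => integrable_konnoMeasure hr0 hr1 hz,
    fun z hz hz1 hz2 => stieltjesTransform_eq_closedForm hr0 hr1 hz hz1 hz2, ?_, fun z hz => ?_⟩
  · rintro z (rfl | rfl)
    · exact tendsto_closedForm hr0 hr1 (one_notMem_realSegment hr1)
    · exact tendsto_closedForm hr0 hr1 (neg_one_notMem_realSegment hr1)
  · obtain ⟨n0, n1, hn, d0, d1, hd⟩ := jacobiFraction_recurrence (jacobiCoeff r) z
    have hne := recurrence_ne_zero hr0 hr1 hz d0 d1 hd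
    exact ⟨hne, tendsto_div_stieltjesTransform hr0 hr1 hz n0 n1 hn d0 d1 hd hne⟩
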